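/- For integers $m\ge 2$ let $\beta(m)=\sum_{j=0}^\infty \frac{(-1)^j}{(2j+1)^m}$ be the values of the Dirichlet beta function, and for $k\in\mathbb N=\{1,2,\dots\}$ let $$h_{2k}=\int_0^\infty \frac{\sinh x}{x\cosh^{2k}x}\,dx .$$ (The series $\beta(2k)$ and the integrals $h_{2k}$, $k\ge 1$, converge absolutely.) Let $t(n,\nu)$ be the central factorial numbers of the first kind, defined for integers $n,\nu\ge 0$ by $t(n,0)=t(0,n)=\delta_{n,0}$, $t(n,n)=1$, $t(n,\nu)=t(n-2,\nu-2)-\tfrac14 (n-2)^2\,t(n-2,\nu)$ for $n\ge 2$, with $t(n,\nu)=0$ if $\nu<0$ or $\nu>n$. For integers $1\le k\le n$ put $$d_{n,k}=\frac{(-1)^n}{4^{k-1}}\sum_{r=1}^k(-1)^r\binom{2k-1}{k-r}(2r-1)^{2n-1}.$$ Then for every $n\in\mathbb N$ $$\frac{\beta(2n)}{\pi^{2n-1}}=\frac{4^{-n}}{(2n-1)!}\sum_{k=1}^n d_{n,k}\,h_{2k},\qquad (\mathrm{i})$$ where, for $1\le k\le n$, $d_{n,k}=\lim_{t\to0}\frac{d^{2n-1}}{dt^{2n-1}}\sin^{2k-1}t$,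 which is also the value of this derivative at $t=0$. The formula (i) inverts the representation $$h_{2n}=\frac{(-1)^n4^n}{(2n-1)!}\sum_{k=1}^n(-1)^k(2k-1)!\,t(2n-1,2k-1)\,\frac{\beta(2k)}{\pi^{2k-1}},\qquad n\in\mathbb N; \qquad (\mathrm{ii})$$ that is, (ii) holds, and for arbitrary real sequences $(a_n)_{n\ge1}$, $(b_n)_{n\ge1}$ one has $a_n=\frac{(-1)^n4^n}{(2n-1)!}\sum_{k=1}^n(-1)^k(2k-1)!\,t(2n-1,2k-1)\,b_k$ for all $n\ge 1$ if and only if $b_n=\frac{4^{-n}}{(2n-1)!}\sum_{k=1}^n d_{n,k}\,a_k$ for all $n\ge 1$. -/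

import Mathlib

open Set Filter Topology MeasureTheory

open scoped Nat

/-- The Dirichlet beta series `β(m) = ∑_{j ≥ 0} (-1)^j / (2j+1)^m` at a natural number `m`
(absolutely convergent for `m ≥ 2`, the only values that are used). -/
noncomputable def dirichletBeta (m : ℕ) : ℝ :=
  ∑' j : ℕ, (-1 : ℝ) ^ j / (2 * (j : ℝ) + 1) ^ m

/-- The integrand `sinh x / (x cosh^m x)`. -/
noncomputable def hIntegrand (m : ℕ) (x : ℝ) : ℝ :=
  Real.sinh x / (x * Real.cosh x ^ m)

/-- `h_m = ∫_0^∞ sinh x / (x cosh^m x) dx`. -/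
noncomputable def hInt (m : ℕ) : ℝ :=
  ∫ x in Ioi (0 : ℝ), hIntegrand m x

/-- `d_{n,k} = (-1)^n / 4^{k-1} * ∑_{r=1}^k (-1)^r binom(2k-1, k-r) (2r-1)^{2n-1}`,
for `n, k ≥ 1`. -/
noncomputable def dCoeff (n k : ℕ) : ℝ :=
  (-1 : ℝ) ^ n / 4 ^ (k - 1) *
    ∑ r ∈ Finset.Icc 1 k,
      (-1 : ℝ) ^ r * (Nat.choose (2 * k - 1) (k - r) : ℝ) * (2 * (r : ℝ) - 1) ^ (2 * n - 1)

/-- The central factorial numbers of the first kind `t(n, ν)`: `t(n, 0) = t(0, n) = δ_{n,0}`,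
`t(n, n) = 1`, and `t(n, ν) = t(n-2, ν-2) - (n-2)^2 / 4 * t(n-2, ν)` for `n ≥ 2`, where
`t(n, ν) = 0` for `ν < 0` or `ν > n`. -/
noncomputable def centralFactorialFirst : ℕ → ℕ → ℝ
  | 0, ν => if ν = 0 then 1 else 0
  | 1, ν => if ν = 1 then 1 else 0
  | _ + 2, 0 => 0
  | n + 2, 1 => -((n : ℝ) ^ 2 / 4) * centralFactorialFirst n 1
  | n + 2, ν + 2 =>
      centralFactorialFirst n ν - (n : ℝ) ^ 2 / 4 * centralFactorialFirst n (ν + 2)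

/-! Formally `∫ sin (t x) dt = 1 / x` over `t > 0`, so `h_{2n}` is the integral over `t` of the sine
transform of `sinh x / cosh^{2n} x`. Integration by parts reduces that transform to the cosine
transform of `sech^{2n-1}`, which by a two-step recursion is `∏ ((2j+1)² + t²)` times an explicit
multiple of `sech (π t / 2)` (`sechPowCos_odd`). Expanding the product with the central factorial
numbers and using that the odd moments of `sech (π t / 2)` are even beta values gives (ii)
(`hInt_eq_sum`). The formal step is made rigorous by truncating at `t = T` and applying the
Riemann–Lebesgue lemma (`integral_sine_transform`).

Formula (i) is then pure linear algebra. Up to signs, powers of 4 and factorials, the matrix of (ii)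
is the array of first-kind numbers with odd indices, whose inverse is the second-kind array. Both
the alternating binomial sums defining `d_{n,k}` and the derivatives of `sin^{2k-1}` at `0` satisfy
the second-kind recurrence after rescaling (`dCoeff_eq`, `iteratedDeriv_sin_pow_zero`). -/

theorem sum_Icc_one_succ (f : ℕ → ℝ) (n : ℕ) :
    ∑ k ∈ Finset.Icc 1 (n + 1), f k = ∑ k ∈ Finset.range (n + 1), f (k + 1) := by
  rw [Finset.range_eq_Ico, Finset.sum_Ico_add' f 0 (n + 1) 1]
  rfl

/-! ### Central factorial numbers of odd indices -/

/-- The central factorial numbers of the first kind with odd indices. -/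
noncomputable def oddFactorialFirst (n k : ℕ) : ℝ := centralFactorialFirst (2 * n + 1) (2 * k + 1)

theorem oddFactorialFirst_zero (k : ℕ) : oddFactorialFirst 0 k = if k = 0 then 1 else 0 := by
  simp [oddFactorialFirst, centralFactorialFirst]

theorem oddFactorialFirst_succ_zero (n : ℕ) :
    oddFactorialFirst (n + 1) 0 = -((2 * (n : ℝ) + 1) ^ 2 / 4) * oddFactorialFirst n 0 := by
  rw [oddFactorialFirst, show 2 * (n + 1) + 1 = (2 * n + 1) + 2 by ring, mul_zero, zero_add,
    centralFactorialFirst]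
  simp [oddFactorialFirst]

theorem oddFactorialFirst_succ_succ (n k : ℕ) :
    oddFactorialFirst (n + 1) (k + 1) =
      oddFactorialFirst n k - (2 * (n : ℝ) + 1) ^ 2 / 4 * oddFactorialFirst n (k + 1) := by
  rw [oddFactorialFirst, show 2 * (n + 1) + 1 = (2 * n + 1) + 2 by ring,
    show 2 * (k + 1) + 1 = (2 * k + 1) + 2 by ring, centralFactorialFirst]
  simp [oddFactorialFirst, mul_add]

theorem oddFactorialFirst_eq_zero_of_lt {n k : ℕ} (h : n < k) : oddFactorialFirst n k = 0 := by
  induction n generalizing k with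
  | zero => simp [oddFactorialFirst_zero, h.ne']
  | succ n ih =>
    obtain ⟨k, rfl⟩ := Nat.exists_eq_succ_of_ne_zero (by lia : k ≠ 0)
    rw [oddFactorialFirst_succ_succ, ih (by lia), ih (by lia)]
    simp

/-- Moves the recurrence from the array onto the test function. Powers as `f` give the generating
polynomial, second-kind numbers give orthogonality. -/
theorem sum_oddFactorialFirst_succ (n : ℕ) (f : ℕ → ℝ) :
    ∑ k ∈ Finset.range (n + 2), oddFactorialFirst (n + 1) k * f k =
      ∑ k ∈ Finset.range (n + 1),
        oddFactorialFirst n k * (f (k + 1) - (2 * (n : ℝ) + 1) ^ 2 / 4 * f k) := by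
  have h : ∑ k ∈ Finset.range (n + 2), oddFactorialFirst n k * f k =
      ∑ k ∈ Finset.range (n + 1), oddFactorialFirst n k * f k := by
    rw [Finset.sum_range_succ, oddFactorialFirst_eq_zero_of_lt (Nat.lt_succ_self n)]
    simp
  simp only [mul_sub, Finset.sum_sub_distrib, mul_left_comm _ ((2 * (n : ℝ) + 1) ^ 2 / 4),
    ← Finset.mul_sum]
  rw [← h, Finset.sum_range_succ', Finset.sum_range_succ' _ (n + 1), oddFactorialFirst_succ_zero]
  simp only [oddFactorialFirst_succ_succ, sub_mul, Finset.sum_sub_distrib, mul_assoc,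
    ← Finset.mul_sum]
  ring

theorem sum_oddFactorialFirst_mul_pow (n : ℕ) (x : ℝ) :
    ∑ k ∈ Finset.range (n + 1), oddFactorialFirst n k * x ^ k =
      ∏ j ∈ Finset.range n, (x - (2 * (j : ℝ) + 1) ^ 2 / 4) := by
  induction n with
  | zero => simp [oddFactorialFirst_zero]
  | succ n ih =>
    rw [sum_oddFactorialFirst_succ, Finset.prod_range_succ, ← ih, Finset.sum_mul]
    exact Finset.sum_congr rfl fun k _ => by ring

/-- The central factorial numbers of the second kind with odd indices. -/
noncomputable def oddFactorialSecond : ℕ → ℕ → ℝ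
  | 0, k => if k = 0 then 1 else 0
  | n + 1, 0 => 1 / 4 * oddFactorialSecond n 0
  | n + 1, k + 1 =>
      oddFactorialSecond n k + (2 * ((k : ℝ) + 1) + 1) ^ 2 / 4 * oddFactorialSecond n (k + 1)

theorem oddFactorialSecond_eq_zero_of_lt {n k : ℕ} (h : n < k) : oddFactorialSecond n k = 0 := by
  induction n generalizing k with
  | zero => simp [oddFactorialSecond, h.ne']
  | succ n ih =>
    obtain ⟨k, rfl⟩ := Nat.exists_eq_succ_of_ne_zero (by lia : k ≠ 0)
    rw [oddFactorialSecond, ih (by lia), ih (by lia)]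
    simp

theorem sum_oddFactorialSecond_succ (n : ℕ) (f : ℕ → ℝ) :
    ∑ k ∈ Finset.range (n + 2), oddFactorialSecond (n + 1) k * f k =
      ∑ k ∈ Finset.range (n + 1),
        oddFactorialSecond n k * (f (k + 1) + (2 * (k : ℝ) + 1) ^ 2 / 4 * f k) := by
  have h : ∑ k ∈ Finset.range (n + 2),
        oddFactorialSecond n k * ((2 * (k : ℝ) + 1) ^ 2 / 4 * f k) =
      ∑ k ∈ Finset.range (n + 1),
        oddFactorialSecond n k * ((2 * (k : ℝ) + 1) ^ 2 / 4 * f k) := by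
    rw [Finset.sum_range_succ, oddFactorialSecond_eq_zero_of_lt (Nat.lt_succ_self n)]
    simp
  simp only [mul_add (oddFactorialSecond n _), Finset.sum_add_distrib]
  rw [← h, Finset.sum_range_succ', Finset.sum_range_succ' _ (n + 1), ← add_assoc,
    ← Finset.sum_add_distrib]
  congr 1
  · refine Finset.sum_congr rfl fun k _ => ?_
    rw [oddFactorialSecond]
    push_cast
    ring
  · rw [oddFactorialSecond]
    push_cast
    ring

/-- After the recurrence is moved onto the first-kind factor, the weights `(2k+1)²/4` cancel and
only a shift of both indices remains. -/
theorem sum_oddFactorialSecond_mul_first (n m : ℕ) :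
    ∑ k ∈ Finset.range (n + 1), oddFactorialSecond n k * oddFactorialFirst k m =
      if n = m then 1 else 0 := by
  induction n generalizing m with
  | zero => simp [oddFactorialSecond, oddFactorialFirst_zero, eq_comm]
  | succ n ih =>
    rw [sum_oddFactorialSecond_succ]
    cases m with
    | zero => simp [oddFactorialFirst_succ_zero]
    | succ m => simp [oddFactorialFirst_succ_succ, ih]

theorem sum_oddFactorialFirst_mul_second (n m : ℕ) :
    ∑ k ∈ Finset.range (n + 1), oddFactorialFirst n k * oddFactorialSecond k m =
      if n = m then 1 else 0 := by
  induction n generalizing m with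
  | zero => simp [oddFactorialSecond, oddFactorialFirst_zero, eq_comm]
  | succ n ih =>
    rw [sum_oddFactorialFirst_succ]
    cases m with
    | zero =>
      have (k : ℕ) : oddFactorialFirst n k * (oddFactorialSecond (k + 1) 0 -
            (2 * (n : ℝ) + 1) ^ 2 / 4 * oddFactorialSecond k 0) =
          (1 / 4 - (2 * (n : ℝ) + 1) ^ 2 / 4) *
            (oddFactorialFirst n k * oddFactorialSecond k 0) := by
        rw [oddFactorialSecond]; ring
      simp_rw [this, ← Finset.mul_sum]
      rw [ih]
      rcases n with _ | n <;> simp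
    | succ m =>
      have (k : ℕ) : oddFactorialFirst n k * (oddFactorialSecond (k + 1) (m + 1) -
            (2 * (n : ℝ) + 1) ^ 2 / 4 * oddFactorialSecond k (m + 1)) =
          oddFactorialFirst n k * oddFactorialSecond k m +
          ((2 * ((m : ℝ) + 1) + 1) ^ 2 / 4 - (2 * (n : ℝ) + 1) ^ 2 / 4) *
            (oddFactorialFirst n k * oddFactorialSecond k (m + 1)) := by
        rw [oddFactorialSecond]; ring
      simp_rw [this, Finset.sum_add_distrib, ← Finset.mul_sum]
      rw [ih, ih]
      -- The leftover factor `(2m+3)² - (2n+1)²` vanishes exactly where the second delta does not.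
      by_cases h : n = m + 1
      · subst h; simp
      · simp [h]

/-- Mutually inverse lower triangular arrays define mutually inverse transformations. -/
theorem eq_sum_of_eq_sum_of_orthogonal {f g : ℕ → ℕ → ℝ}
    (hf : ∀ n k, n < k → f n k = 0)
    (hgf : ∀ n m, ∑ k ∈ Finset.range (n + 1), g n k * f k m = if n = m then 1 else 0)
    {a b : ℕ → ℝ} (h : ∀ n, a n = ∑ k ∈ Finset.range (n + 1), f n k * b k) (n : ℕ) :
    b n = ∑ k ∈ Finset.range (n + 1), g n k * a k := by
  have h1 : ∀ k ∈ Finset.range (n + 1), g n k * a k =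
      ∑ m ∈ Finset.range (n + 1), g n k * f k m * b m := by
    intro k hk
    rw [h, Finset.mul_sum]
    simp_rw [← mul_assoc]
    refine Finset.sum_subset (Finset.range_mono (Finset.mem_range.mp hk)) fun m _ hm => ?_
    rw [hf k m (by simpa using hm)]
    simp
  rw [Finset.sum_congr rfl h1, Finset.sum_comm]
  simp_rw [← Finset.sum_mul, hgf]
  simp

/-! ### The coefficients `dCoeff` -/

/-- The alternating binomial sums underlying `dCoeff`. -/
noncomputable def oddPowerSum (n k : ℕ) : ℝ :=
  ∑ i ∈ Finset.range (k + 1),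
    (-1 : ℝ) ^ i * ((2 * k + 1).choose i : ℝ) * (2 * (k : ℝ) + 1 - 2 * i) ^ (2 * n + 1)

theorem dCoeff_succ_succ (n k : ℕ) :
    dCoeff (n + 1) (k + 1) = (-1) ^ (n + k) / 4 ^ k * oddPowerSum n k := by
  rw [dCoeff, sum_Icc_one_succ, oddPowerSum, ← Finset.sum_range_reflect, Finset.mul_sum,
    Finset.mul_sum]
  refine Finset.sum_congr rfl fun i hi => ?_
  obtain ⟨j, rfl⟩ := Nat.exists_eq_add_of_le (Nat.lt_succ_iff.mp (Finset.mem_range.mp hi))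
  -- The original summation index is `r = j + 1`, with `i = k + 1 - r`.
  rw [show i + j + 1 - 1 - i = j by lia, show i + j + 1 - (j + 1) = i by lia,
    show 2 * (i + j + 1) - 1 = 2 * (i + j) + 1 by lia, show 2 * (n + 1) - 1 = 2 * n + 1 by lia,
    Nat.add_sub_cancel]
  have h : ((-1 : ℝ) ^ i) * (-1) ^ i = 1 := by rw [← mul_pow]; simp
  push_cast
  rw [show (2 * ((j : ℝ) + 1) - 1) = 2 * (i + j) + 1 - 2 * i by ring]
  rw [pow_add _ n (i + j), pow_add _ i j, pow_succ _ n, pow_succ _ j]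
  linear_combination (-(-1) ^ n / 4 ^ (i + j) * (-1) ^ j *
    ((2 * (i + j) + 1).choose i : ℝ) * (2 * ((i : ℝ) + j) + 1 - 2 * i) ^ (2 * n + 1)) * h

/-- Absorption applied twice. For `N = 2k+1` the factor on the left is a quarter of `(2k+3)² -
(2k+1-2i)²`. -/
theorem choose_mul_sub_mul (N i : ℕ) :
    ((N + 2).choose (i + 1) : ℝ) * ((i + 1) * ((N : ℝ) + 1 - i)) =
      (N + 2) * (N + 1) * (N.choose i : ℝ) := by
  have h1 : ((N + 2 : ℕ) : ℝ) * ((N + 1).choose i : ℝ) = ((N + 2).choose (i + 1) : ℝ) * (i + 1) := by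
    exact_mod_cast Nat.add_one_mul_choose_eq (N + 1) i
  have h2 : ((N + 1).choose i : ℝ) * ((N : ℝ) + 1 - i) = (N + 1) * (N.choose i : ℝ) := by
    rcases le_or_gt i (N + 1) with h | h
    · have := Nat.choose_mul_succ_eq N i
      have h3 : ((N + 1 - i : ℕ) : ℝ) = (N : ℝ) + 1 - i := by push_cast [Nat.cast_sub h]; ring
      rw [← h3]
      have : ((N.choose i * (N + 1) : ℕ) : ℝ) = (((N + 1).choose i * (N + 1 - i) : ℕ) : ℝ) := by
        rw [this]
      push_cast at this ⊢
      linarith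
    · simp [Nat.choose_eq_zero_of_lt h, Nat.choose_eq_zero_of_lt (by lia : N < i)]
  push_cast at h1
  linear_combination ((N : ℝ) + 1 - i) * (-h1) + ((N : ℝ) + 2) * h2

theorem oddPowerSum_succ_zero (n : ℕ) : oddPowerSum (n + 1) 0 = oddPowerSum n 0 := by
  simp [oddPowerSum]

/-- Raising the exponent by two multiplies each term by `(2k+3-2i)² = (2k+3)² - 4i(2k+3-i)`. The
subtracted part is absorbed into the binomial coefficient, which lowers `k` and shifts `i`. -/
theorem oddPowerSum_succ_succ (n k : ℕ) :
    oddPowerSum (n + 1) (k + 1) = (2 * (k : ℝ) + 3) ^ 2 * oddPowerSum n (k + 1) +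
      4 * (2 * k + 3) * (2 * k + 2) * oddPowerSum n k := by
  simp only [oddPowerSum]
  rw [Finset.sum_range_succ', Finset.sum_range_succ' _ (k + 1), mul_add (_ ^ 2),
    Finset.mul_sum, Finset.mul_sum, add_right_comm, ← Finset.sum_add_distrib]
  congr 1
  · refine Finset.sum_congr rfl fun i _ => ?_
    have := choose_mul_sub_mul (2 * k + 1) i
    rw [show 2 * (k + 1) + 1 = 2 * k + 1 + 2 by ring]
    push_cast at this ⊢
    rw [show 2 * (n + 1) + 1 = 2 * n + 1 + 2 by ring,
      show (2 * ((k : ℝ) + 1) + 1 - 2 * (i + 1)) = 2 * k + 1 - 2 * i by ring]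
    rw [pow_add _ (2 * n + 1) 2, pow_succ _ i]
    linear_combination (4 * (-1) ^ i * (2 * (k : ℝ) + 1 - 2 * i) ^ (2 * n + 1)) * this
  · push_cast
    simp
    ring

theorem choose_succ_mul_cast (N i : ℕ) :
    (N.choose (i + 1) : ℝ) * (i + 1) = N.choose i * ((N : ℝ) - i) := by
  rcases le_or_gt i N with h | h
  · rw [← Nat.cast_sub h]
    exact_mod_cast Nat.choose_succ_right_eq N i
  · simp [Nat.choose_eq_zero_of_lt h, Nat.choose_eq_zero_of_lt (h.trans (Nat.lt_succ_self i))]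

/-- A telescoping closed form. For `N = 2k+1`, `m = k` it contains the difference of the two equal
middle binomials, so the sum vanishes, which is the base case `n = 0` for `oddPowerSum`. -/
theorem sum_alternating_choose_mul (N m : ℕ) :
    ∑ i ∈ Finset.range (m + 2), (-1 : ℝ) ^ i * ((N + 2).choose i : ℝ) * ((N : ℝ) + 2 - 2 * i) =
      (-1) ^ (m + 1) * (N + 2) * ((N.choose (m + 1) : ℝ) - N.choose m) := by
  induction m with
  | zero =>
    simp [Finset.sum_range_succ]
    ring
  | succ m ih =>
    rw [Finset.sum_range_succ, ih]
    have h1 := choose_succ_mul_cast N m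
    have h2 := choose_succ_mul_cast N (m + 1)
    rw [show m + 1 + 1 = m + 2 from rfl, Nat.choose_succ_succ' (N + 1), Nat.choose_succ_succ' N,
      Nat.choose_succ_succ' N]
    push_cast at h2 ⊢
    linear_combination ((-1) ^ m * 2) * (-h1 - h2)

theorem oddPowerSum_zero_left (k : ℕ) : oddPowerSum 0 k = if k = 0 then 1 else 0 := by
  cases k with
  | zero => simp [oddPowerSum]
  | succ k =>
    have h := sum_alternating_choose_mul (2 * k + 1) k
    rw [Nat.choose_symm_half, sub_self, mul_zero] at h
    rw [if_neg k.succ_ne_zero, ← h, oddPowerSum]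
    refine Finset.sum_congr rfl fun i _ => ?_
    push_cast
    ring_nf

theorem oddPowerSum_eq (n k : ℕ) :
    oddPowerSum n k = 4 ^ n * ((2 * k + 1)! : ℝ) * oddFactorialSecond n k := by
  induction n generalizing k with
  | zero => cases k <;> simp [oddPowerSum_zero_left, oddFactorialSecond]
  | succ n ih =>
    cases k with
    | zero =>
      rw [oddPowerSum_succ_zero, ih, oddFactorialSecond]
      ring
    | succ k =>
      rw [oddPowerSum_succ_succ, ih, ih, oddFactorialSecond,
        show 2 * (k + 1) + 1 = 2 * k + 1 + 1 + 1 by ring, Nat.factorial_succ (2 * k + 1 + 1),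
        Nat.factorial_succ (2 * k + 1)]
      push_cast
      ring

theorem dCoeff_eq (n k : ℕ) :
    dCoeff (n + 1) (k + 1) =
      (-1) ^ (n + k) * 4 ^ n / 4 ^ k * ((2 * k + 1)! : ℝ) * oddFactorialSecond n k := by
  rw [dCoeff_succ_succ, oddPowerSum_eq]
  ring

/-! ### Derivatives of odd powers of the sine -/

theorem contDiff_sin_pow (m : ℕ) : ContDiff ℝ ⊤ fun u : ℝ => Real.sin u ^ m :=
  Real.contDiff_sin.pow m

theorem deriv_deriv_sin_pow (m : ℕ) :
    deriv (deriv fun u : ℝ => Real.sin u ^ (m + 2)) = fun u : ℝ =>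
      ((m : ℝ) + 2) * (m + 1) * Real.sin u ^ m - ((m : ℝ) + 2) ^ 2 * Real.sin u ^ (m + 2) := by
  have h1 : deriv (fun u : ℝ => Real.sin u ^ (m + 2)) = fun u =>
      ((m : ℝ) + 2) * Real.sin u ^ (m + 1) * Real.cos u := by
    ext u
    simp
  ext u
  rw [h1]
  have := ((((Real.hasDerivAt_sin u).pow (m + 1)).const_mul ((m : ℝ) + 2)).mul
    (Real.hasDerivAt_cos u)).deriv
  refine (Eq.trans ?_ this).trans ?_
  · rfl
  · simp only [Nat.add_sub_cancel, Pi.pow_apply]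
    push_cast
    linear_combination ((m : ℝ) + 2) * (m + 1) * Real.sin u ^ m * Real.cos_sq' u

theorem iteratedDeriv_sin_zero (n : ℕ) :
    iteratedDeriv (2 * n + 1) (fun u : ℝ => Real.sin u ^ 1) 0 = (-1) ^ n := by
  simp

/-- Differentiating an odd power of sine twice, innermost first, reproduces the second-kind
recurrence, so no expansion into exponentials is needed. -/
theorem iteratedDeriv_sin_pow_zero (n k : ℕ) :
    iteratedDeriv (2 * n + 1) (fun u : ℝ => Real.sin u ^ (2 * k + 1)) 0 =
      (-1) ^ (n + k) * 4 ^ n / 4 ^ k * ((2 * k + 1)! : ℝ) * oddFactorialSecond n k := by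
  induction n generalizing k with
  | zero =>
    rw [mul_zero, zero_add, iteratedDeriv_one]
    have := ((Real.hasDerivAt_sin 0).pow (2 * k + 1)).deriv
    refine Eq.trans ?_ (this.trans ?_)
    · rfl
    · cases k <;> simp [oddFactorialSecond]
  | succ n ih =>
    cases k with
    | zero =>
      -- The derivatives of sine itself are known, so the induction hypothesis already determines
      -- the column `k = 0`.
      have h := ih 0
      rw [mul_zero, zero_add, iteratedDeriv_sin_zero] at h
      rw [mul_zero, zero_add, iteratedDeriv_sin_zero, oddFactorialSecond]
      linear_combination (-1) * h
    | succ k =>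
      rw [show 2 * (n + 1) + 1 = 2 * n + 1 + 1 + 1 by ring, iteratedDeriv_succ',
        iteratedDeriv_succ', show 2 * (k + 1) + 1 = 2 * k + 1 + 2 by ring, deriv_deriv_sin_pow,
        iteratedDeriv_fun_sub, iteratedDeriv_const_mul_field, iteratedDeriv_const_mul_field, ih,
        show 2 * k + 1 + 2 = 2 * (k + 1) + 1 by ring, ih, oddFactorialSecond,
        show 2 * (k + 1) + 1 = 2 * k + 1 + 1 + 1 by ring, Nat.factorial_succ (2 * k + 1 + 1),
        Nat.factorial_succ (2 * k + 1)]
      · push_cast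
        ring
      · exact (contDiff_const.mul ((contDiff_sin_pow _).of_le le_top)).contDiffAt
      · exact (contDiff_const.mul ((contDiff_sin_pow _).of_le le_top)).contDiffAt

theorem tendsto_iteratedDeriv_sin_pow (n k : ℕ) :
    Tendsto (fun t : ℝ => iteratedDeriv n (fun u : ℝ => Real.sin u ^ k) t) (𝓝[≠] 0)
      (𝓝 (iteratedDeriv n (fun u : ℝ => Real.sin u ^ k) 0)) :=
  (((contDiff_sin_pow k).continuous_iteratedDeriv n (mod_cast le_top)).tendsto 0).mono_left
    nhdsWithin_le_nhds

/-! ### Bounds for powers of the hyperbolic secant -/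

theorem inv_cosh_pow_le {m : ℕ} (hm : m ≠ 0) (x : ℝ) :
    1 / Real.cosh x ^ m ≤ 2 * Real.exp (-x) := by
  have h1 : Real.cosh x ≤ Real.cosh x ^ m := le_self_pow₀ (Real.one_le_cosh x) hm
  have h2 : Real.exp x / 2 ≤ Real.cosh x := by
    rw [Real.cosh_eq]; linarith [Real.exp_pos (-x)]
  calc 1 / Real.cosh x ^ m ≤ 1 / (Real.exp x / 2) :=
        one_div_le_one_div_of_le (by positivity) (h2.trans h1)
    _ = 2 * Real.exp (-x) := by rw [Real.exp_neg]; field_simp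

theorem integrableOn_Ioi_of_abs_le {f : ℝ → ℝ} {m : ℕ} (hm : m ≠ 0) (hf : Measurable f)
    (h : ∀ x, 0 < x → |f x| ≤ 1 / Real.cosh x ^ m) : IntegrableOn f (Ioi 0) := by
  have h2 : IntegrableOn (fun x => 2 * Real.exp (-x)) (Ioi 0) :=
    (integrableOn_exp_neg_Ioi 0).const_mul 2
  refine h2.mono' hf.aestronglyMeasurable ?_
  filter_upwards [ae_restrict_mem measurableSet_Ioi] with x hx
  exact (h x hx).trans (inv_cosh_pow_le hm x)

/-- Controls the factor `1 / x` at the origin: `hIntegrand m` is bounded by `1 / cosh^(m-1)`. -/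
theorem sinh_le_mul_cosh {x : ℝ} (hx : 0 ≤ x) : Real.sinh x ≤ x * Real.cosh x := by
  have hd (y : ℝ) : HasDerivAt (fun y => y * Real.cosh y - Real.sinh y) (y * Real.sinh y) y := by
    convert! ((hasDerivAt_id y).mul (Real.hasDerivAt_cosh y)).sub (Real.hasDerivAt_sinh y) using 1
    simp
  have hmono : MonotoneOn (fun y => y * Real.cosh y - Real.sinh y) (Ici 0) := by
    refine monotoneOn_of_deriv_nonneg (convex_Ici 0) (fun y _ => (hd y).continuousAt.continuousWithinAt)
      (fun y _ => (hd y).differentiableAt.differentiableWithinAt) fun y hy => ?_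
    rw [interior_Ici] at hy
    rw [(hd y).deriv]
    exact mul_nonneg hy.le (Real.sinh_nonneg_iff.mpr hy.le)
  simpa using hmono self_mem_Ici hx hx

theorem abs_sinh_le_cosh (x : ℝ) : |Real.sinh x| ≤ Real.cosh x := by
  rw [abs_le]
  constructor
  · linarith [Real.sinh_add_cosh x, Real.exp_pos x]
  · exact (Real.sinh_lt_cosh x).le

theorem measurable_hIntegrand (m : ℕ) : Measurable (hIntegrand m) := by
  unfold hIntegrand
  fun_prop

theorem integrableOn_hIntegrand {m : ℕ} (hm : 2 ≤ m) : IntegrableOn (hIntegrand m) (Ioi 0) := by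
  refine integrableOn_Ioi_of_abs_le (m := m - 1) (by lia) (measurable_hIntegrand m) fun x hx => ?_
  obtain ⟨k, rfl⟩ := Nat.exists_eq_add_of_le' hm
  have hc := Real.cosh_pos x
  rw [hIntegrand, abs_of_nonneg (div_nonneg (Real.sinh_nonneg_iff.mpr hx.le) (by positivity)),
    div_le_div_iff₀ (by positivity) (by positivity)]
  rw [show k + 2 - 1 = k + 1 by lia, pow_succ _ (k + 1)]
  nlinarith [sinh_le_mul_cosh hx.le, pow_pos hc (k + 1)]

/-! ### Cosine transforms of powers of the hyperbolic secant -/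

/-- The cosine transform of `1 / cosh ^ m`. -/
noncomputable def sechPowCos (m : ℕ) (t : ℝ) : ℝ :=
  ∫ x in Ioi (0 : ℝ), Real.cos (t * x) / Real.cosh x ^ m

theorem integrableOn_cos_div_cosh_pow {m : ℕ} (hm : m ≠ 0) (t : ℝ) :
    IntegrableOn (fun x => Real.cos (t * x) / Real.cosh x ^ m) (Ioi 0) := by
  refine integrableOn_Ioi_of_abs_le hm (by fun_prop) fun x _ => ?_
  have := Real.cosh_pos x
  rw [abs_div, abs_of_pos (pow_pos this m)]
  gcongr
  exact Real.abs_cos_le_one _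

theorem abs_mul_sinh_div_cosh_pow_le (m : ℕ) {c : ℝ} (hc : |c| ≤ 1) (x : ℝ) :
    |c * (Real.sinh x / Real.cosh x ^ (m + 1))| ≤ 1 / Real.cosh x ^ m := by
  have := Real.cosh_pos x
  rw [abs_mul, abs_div, abs_of_pos (pow_pos this (m + 1))]
  calc |c| * (|Real.sinh x| / Real.cosh x ^ (m + 1))
      ≤ 1 * (Real.cosh x / Real.cosh x ^ (m + 1)) := by
        gcongr
        exact abs_sinh_le_cosh x
    _ = 1 / Real.cosh x ^ m := by
        field_simp
        ring

theorem tendsto_atTop_of_abs_le {f : ℝ → ℝ} {m : ℕ} (hm : m ≠ 0)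
    (h : ∀ x, |f x| ≤ 1 / Real.cosh x ^ m) : Tendsto f atTop (𝓝 0) := by
  refine squeeze_zero_norm (fun x => (h x).trans (inv_cosh_pow_le hm x)) ?_
  simpa using (Real.tendsto_exp_neg_atTop_nhds_zero.const_mul 2)

theorem hasDerivAt_inv_cosh_pow (m : ℕ) (x : ℝ) :
    HasDerivAt (fun x => 1 / Real.cosh x ^ m)
      (-(m * (Real.sinh x / Real.cosh x ^ (m + 1)))) x := by
  have hc := (Real.cosh_pos x).ne'
  convert! ((Real.hasDerivAt_cosh x).pow m).inv (pow_ne_zero m hc) using 1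
  · ext; simp
  · cases m with
    | zero => simp
    | succ m =>
      simp only [Pi.pow_apply, Nat.add_sub_cancel]
      field_simp
      ring

theorem hasDerivAt_sinh_div_cosh_pow (m : ℕ) (x : ℝ) :
    HasDerivAt (fun x => Real.sinh x / Real.cosh x ^ (m + 1))
      ((m + 1) / Real.cosh x ^ (m + 2) - m / Real.cosh x ^ m) x := by
  have hc := (Real.cosh_pos x).ne'
  convert! (Real.hasDerivAt_sinh x).mul (hasDerivAt_inv_cosh_pow (m + 1) x) using 1
  · ext; simp [div_eq_mul_inv]
  · have h := Real.sinh_sq x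
    have h1 : m / Real.cosh x ^ m = m * Real.cosh x ^ 2 * (1 / Real.cosh x ^ (m + 2)) := by
      rw [pow_add]; field_simp
    have h2 : Real.cosh x * (1 / Real.cosh x ^ (m + 1)) =
        Real.cosh x ^ 2 * (1 / Real.cosh x ^ (m + 2)) := by
      rw [pow_succ, pow_add _ m 2]; field_simp
    rw [h1, h2]
    push_cast
    linear_combination ((m : ℝ) + 1) * (1 / Real.cosh x ^ (m + 2)) * h

theorem hasDerivAt_sin_mul (t x : ℝ) :
    HasDerivAt (fun x => Real.sin (t * x)) (t * Real.cos (t * x)) x := by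
  simpa [mul_comm] using! ((hasDerivAt_id x).const_mul t).sin

theorem hasDerivAt_cos_mul (t x : ℝ) :
    HasDerivAt (fun x => Real.cos (t * x)) (-(t * Real.sin (t * x))) x := by
  simpa [mul_comm] using! ((hasDerivAt_id x).const_mul t).cos

theorem integrableOn_sin_mul_sinh_div_cosh_pow {m : ℕ} (hm : m ≠ 0) (t : ℝ) :
    IntegrableOn (fun x => Real.sin (t * x) * (Real.sinh x / Real.cosh x ^ (m + 1))) (Ioi 0) :=
  integrableOn_Ioi_of_abs_le hm (by fun_prop) fun x _ =>
    abs_mul_sinh_div_cosh_pow_le m (Real.abs_sin_le_one _) x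

theorem abs_sin_div_cosh_pow_le (m : ℕ) (t x : ℝ) :
    |Real.sin (t * x) * (1 / Real.cosh x ^ m)| ≤ 1 / Real.cosh x ^ m := by
  have := Real.cosh_pos x
  rw [abs_mul, abs_of_pos (show 0 < 1 / Real.cosh x ^ m by positivity)]
  exact mul_le_of_le_one_left (by positivity) (Real.abs_sin_le_one _)

theorem integral_sin_mul_sinh_div_cosh_pow {m : ℕ} (hm : m ≠ 0) (t : ℝ) :
    ∫ x in Ioi (0 : ℝ), Real.sin (t * x) * (Real.sinh x / Real.cosh x ^ (m + 1)) =
      t / m * sechPowCos m t := by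
  have hd (x : ℝ) : HasDerivAt (fun x => Real.sin (t * x) * (1 / Real.cosh x ^ m))
      (t * (Real.cos (t * x) / Real.cosh x ^ m) -
        m * (Real.sin (t * x) * (Real.sinh x / Real.cosh x ^ (m + 1)))) x := by
    convert! (hasDerivAt_sin_mul t x).mul (hasDerivAt_inv_cosh_pow m x) using 1
    ring
  have h := integral_Ioi_of_hasDerivAt_of_tendsto' (a := 0) (fun x _ => hd x)
    (((integrableOn_cos_div_cosh_pow hm t).const_mul t).sub
      ((integrableOn_sin_mul_sinh_div_cosh_pow hm t).const_mul m))
    (tendsto_atTop_of_abs_le hm (abs_sin_div_cosh_pow_le m t))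
  rw [integral_sub ((integrableOn_cos_div_cosh_pow hm t).const_mul t)
    ((integrableOn_sin_mul_sinh_div_cosh_pow hm t).const_mul m), integral_const_mul,
    integral_const_mul] at h
  have hm' : (m : ℝ) ≠ 0 := Nat.cast_ne_zero.mpr hm
  simp only [mul_zero, Real.sin_zero, zero_mul, sub_zero] at h
  rw [sechPowCos, div_mul_eq_mul_div, eq_div_iff hm']
  linarith

/-- Integrate the derivative of `cos (t x) sinh x / cosh^(m+1) x`, whose boundary values vanish. The
sine integral that appears is converted back by `integral_sin_mul_sinh_div_cosh_pow`. -/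
theorem sechPowCos_add_two {m : ℕ} (hm : m ≠ 0) (t : ℝ) :
    sechPowCos (m + 2) t = ((m : ℝ) ^ 2 + t ^ 2) / (m * (m + 1)) * sechPowCos m t := by
  have hd (x : ℝ) : HasDerivAt (fun x => Real.cos (t * x) * (Real.sinh x / Real.cosh x ^ (m + 1)))
      ((m + 1) * (Real.cos (t * x) / Real.cosh x ^ (m + 2)) -
        m * (Real.cos (t * x) / Real.cosh x ^ m) -
        t * (Real.sin (t * x) * (Real.sinh x / Real.cosh x ^ (m + 1)))) x := by
    convert! (hasDerivAt_cos_mul t x).mul (hasDerivAt_sinh_div_cosh_pow m x) using 1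
    ring
  have i1 := (integrableOn_cos_div_cosh_pow (m := m + 2) (by lia) t).const_mul ((m : ℝ) + 1)
  have i2 := (integrableOn_cos_div_cosh_pow hm t).const_mul (m : ℝ)
  have i3 := (integrableOn_sin_mul_sinh_div_cosh_pow hm t).const_mul t
  have i12 : IntegrableOn (fun x => (m + 1) * (Real.cos (t * x) / Real.cosh x ^ (m + 2)) -
      m * (Real.cos (t * x) / Real.cosh x ^ m)) (Ioi 0) := i1.sub i2
  have h := integral_Ioi_of_hasDerivAt_of_tendsto' (a := 0) (fun x _ => hd x) (i12.sub i3)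
    (tendsto_atTop_of_abs_le hm fun x => abs_mul_sinh_div_cosh_pow_le m (Real.abs_cos_le_one _) x)
  rw [integral_sub i12 i3, integral_sub i1 i2, integral_const_mul, integral_const_mul,
    integral_const_mul, integral_sin_mul_sinh_div_cosh_pow hm] at h
  have hm' : (m : ℝ) ≠ 0 := Nat.cast_ne_zero.mpr hm
  simp only [Real.sinh_zero, zero_div, mul_zero, sub_zero] at h
  change (m + 1) * sechPowCos (m + 2) t - m * sechPowCos m t - _ = 0 at h
  field_simp at h ⊢
  linarith

/-! ### The cosine transform of the hyperbolic secant -/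

/-- The logistic substitution mapping `ℝ` onto `(0, 1)`. -/
noncomputable def logistic (x : ℝ) : ℝ := (1 + Real.exp (-(2 * x)))⁻¹

theorem logistic_pos (x : ℝ) : 0 < logistic x := by
  have := Real.exp_pos (-(2 * x))
  unfold logistic
  positivity

theorem one_sub_logistic (x : ℝ) : 1 - logistic x = Real.exp (-(2 * x)) * logistic x := by
  have := Real.exp_pos (-(2 * x))
  unfold logistic
  field_simp
  ring

theorem hasDerivAt_logistic (x : ℝ) :
    HasDerivAt logistic (2 * Real.exp (-(2 * x)) * logistic x ^ 2) x := by
  have := Real.exp_pos (-(2 * x))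
  have h : HasDerivAt (fun x : ℝ => 1 + Real.exp (-(2 * x))) (-(2 * Real.exp (-(2 * x)))) x := by
    convert! (((hasDerivAt_id x).const_mul 2).neg.exp).const_add 1 using 1
    simp
    ring
  convert! h.inv (by positivity) using 1
  unfold logistic
  field_simp

theorem logistic_injective : Function.Injective logistic := by
  intro x y h
  have h1 := inv_injective h
  have h2 := Real.exp_injective (add_left_cancel h1)
  linarith

theorem image_logistic : logistic '' univ = Ioo 0 1 := by
  ext y
  constructor
  · rintro ⟨x, -, rfl⟩
    have h := mul_pos (Real.exp_pos (-(2 * x))) (logistic_pos x)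
    rw [← one_sub_logistic] at h
    exact ⟨logistic_pos x, by linarith⟩
  · rintro ⟨h0, h1⟩
    refine ⟨-(Real.log ((1 - y) / y) / 2), trivial, ?_⟩
    have : 0 < (1 - y) / y := div_pos (by linarith) h0
    rw [logistic, show -(2 * -(Real.log ((1 - y) / y) / 2)) = Real.log ((1 - y) / y) by ring,
      Real.exp_log this]
    field_simp
    ring

/-- For `y = logistic x` one has `y / (1 - y) = e^{2x}`, so the imaginary exponents produce
`e^{itx}`, while the Jacobian `2y(1-y)` times `(y(1-y))^{-1/2}` is `sech x`. -/
theorem logistic_betaIntegrand (t x : ℝ) :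
    |2 * Real.exp (-(2 * x)) * logistic x ^ 2| •
      ((logistic x : ℂ) ^ ((1 + t * Complex.I) / 2 - 1) *
        (1 - (logistic x : ℂ)) ^ ((1 - t * Complex.I) / 2 - 1)) =
      Complex.exp ((t * x : ℝ) * Complex.I) * ((1 / Real.cosh x : ℝ) : ℂ) := by
  have hp := logistic_pos x
  have he := Real.exp_pos (-(2 * x))
  have h1 : (1 - (logistic x : ℂ)) = ((Real.exp (-(2 * x)) * logistic x : ℝ) : ℂ) := by
    rw [← one_sub_logistic]; push_cast; ring
  have hE : (logistic x : ℂ) = Complex.exp (Real.log (logistic x)) := by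
    rw [← Complex.ofReal_exp, Real.exp_log hp]
  rw [abs_of_pos (by positivity), h1, Complex.cpow_def_of_ne_zero (by exact_mod_cast hp.ne'),
    Complex.cpow_def_of_ne_zero (by exact_mod_cast (mul_pos he hp).ne'), ← Complex.ofReal_log hp.le,
    ← Complex.ofReal_log (mul_pos he hp).le, Real.log_mul he.ne' hp.ne', Real.log_exp,
    ← Complex.exp_add, Complex.real_smul]
  have hexp : (Real.log (logistic x) : ℂ) * ((1 + t * Complex.I) / 2 - 1) +
      ((-(2 * x) + Real.log (logistic x) : ℝ) : ℂ) * ((1 - t * Complex.I) / 2 - 1) =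
      -(Real.log (logistic x) : ℂ) + x + (t * x : ℝ) * Complex.I := by
    push_cast; ring
  rw [hexp, Complex.exp_add, Complex.exp_add, Complex.exp_neg, ← hE, mul_comm]
  rw [mul_assoc, mul_comm]
  rw [mul_assoc]
  congr 1
  rw [← Complex.ofReal_exp, ← Complex.ofReal_inv, ← Complex.ofReal_mul, ← Complex.ofReal_mul]
  congr 1
  have h2 : Real.exp (-(2 * x)) = (Real.exp x)⁻¹ ^ 2 := by
    rw [← Real.exp_neg, ← Real.exp_nat_mul]; congr 1; push_cast; ring
  rw [Real.cosh_eq, logistic, h2, Real.exp_neg]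
  have := Real.exp_pos x
  field_simp

/-- The substitution yields `B(s, 1-s) = Γ(s)Γ(1-s)` with `s = (1 + it)/2`, and the reflection
formula turns this into `π / sin (π s)`. -/
theorem integral_exp_div_cosh (t : ℝ) :
    ∫ x : ℝ, Complex.exp ((t * x : ℝ) * Complex.I) * ((1 / Real.cosh x : ℝ) : ℂ) =
      ((Real.pi / Real.cosh (Real.pi * t / 2) : ℝ) : ℂ) := by
  have h := integral_image_eq_integral_abs_deriv_smul MeasurableSet.univ
    (fun x _ => (hasDerivAt_logistic x).hasDerivWithinAt) logistic_injective.injOn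
    (fun y : ℝ => (y : ℂ) ^ ((1 + t * Complex.I) / 2 - 1) *
        (1 - (y : ℂ)) ^ ((1 - t * Complex.I) / 2 - 1))
  simp only [logistic_betaIntegrand, image_logistic, Measure.restrict_univ] at h
  rw [← h, ← integral_Ioc_eq_integral_Ioo, ← intervalIntegral.integral_of_le zero_le_one]
  change Complex.betaIntegral _ _ = _
  have hΓ := Complex.Gamma_mul_Gamma_eq_betaIntegral (s := (1 + t * Complex.I) / 2)
    (t := (1 - t * Complex.I) / 2) (by simp) (by simp)
  rw [show (1 + t * Complex.I) / 2 + (1 - t * Complex.I) / 2 = 1 by ring, Complex.Gamma_one,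
    one_mul] at hΓ
  rw [← hΓ, show (1 - t * Complex.I) / 2 = 1 - (1 + t * Complex.I) / 2 by ring,
    Complex.Gamma_mul_Gamma_one_sub,
    show (Real.pi : ℂ) * ((1 + t * Complex.I) / 2) =
      (Real.pi * t / 2 : ℝ) * Complex.I + Real.pi / 2 by push_cast; ring,
    Complex.sin_add_pi_div_two, Complex.cos_mul_I]
  push_cast
  rfl

theorem sechPowCos_one (t : ℝ) :
    sechPowCos 1 t = Real.pi / 2 / Real.cosh (Real.pi * t / 2) := by
  have h := integral_exp_div_cosh t
  have hint : Integrable fun x : ℝ =>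
      Complex.exp ((t * x : ℝ) * Complex.I) * ((1 / Real.cosh x : ℝ) : ℂ) := by
    -- A non-integrable function has integral `0` by convention, so the nonzero value just computed
    -- forces integrability.
    refine .of_integral_ne_zero ?_
    rw [h]
    exact_mod_cast (div_pos Real.pi_pos (Real.cosh_pos _)).ne'
  have h2 := congrArg Complex.re h
  rw [Complex.ofReal_re, ← RCLike.re_eq_complex_re, ← integral_re hint] at h2
  have h3 : ∫ x : ℝ, Real.cos (t * |x|) / Real.cosh |x| ^ 1 =
      Real.pi / Real.cosh (Real.pi * t / 2) := by
    rw [← h2]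
    refine integral_congr_ae (.of_forall fun x => ?_)
    have e1 : Real.cos (t * |x|) = Real.cos (t * x) := by
      rcases abs_choice x with h | h <;> simp [h]
    simp only [RCLike.re_eq_complex_re, Complex.re_mul_ofReal, Complex.exp_ofReal_mul_I_re, e1,
      Real.cosh_abs, pow_one]
    ring
  rw [integral_comp_abs (f := fun x => Real.cos (t * x) / Real.cosh x ^ 1)] at h3
  rw [sechPowCos, div_div, mul_comm 2, ← div_div, ← h3]
  ring

theorem sechPowCos_odd (n : ℕ) (t : ℝ) :
    sechPowCos (2 * n + 1) t =
      (∏ j ∈ Finset.range n, ((2 * (j : ℝ) + 1) ^ 2 + t ^ 2)) / ((2 * n)! : ℝ) *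
        (Real.pi / 2 / Real.cosh (Real.pi * t / 2)) := by
  induction n with
  | zero => simp [sechPowCos_one]
  | succ n ih =>
    rw [show 2 * (n + 1) + 1 = 2 * n + 1 + 2 by ring, sechPowCos_add_two (by lia), ih,
      Finset.prod_range_succ, show 2 * (n + 1) = 2 * n + 1 + 1 by ring,
      Nat.factorial_succ (2 * n + 1), Nat.factorial_succ (2 * n)]
    have := Real.cosh_pos (Real.pi * t / 2)
    have : ((2 * n)! : ℝ) ≠ 0 := by positivity
    push_cast
    field_simp

/-! ### Integrating the sine transform -/

theorem tendsto_integral_cos_mul {h : ℝ → ℝ} (hh : IntegrableOn h (Ioi 0)) :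
    Tendsto (fun T : ℝ => ∫ x in Ioi (0 : ℝ), h x * Real.cos (T * x)) atTop (𝓝 0) := by
  have h1 := Real.tendsto_integral_exp_smul_cocompact
    (fun x => (((Ioi (0 : ℝ)).indicator h x : ℝ) : ℂ))
  -- The Fourier character carries a factor `2π`, so frequency `T` corresponds to `T / (2π)`.
  have h2 : Tendsto (fun T : ℝ => T / (2 * Real.pi)) atTop (cocompact ℝ) :=
    (tendsto_id.atTop_div_const (by positivity)).mono_right atTop_le_cocompact
  have h3 := (Complex.continuous_re.tendsto 0).comp (h1.comp h2)
  rw [Complex.zero_re] at h3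
  refine h3.congr fun T => ?_
  have hi : Integrable fun v : ℝ => Real.fourierChar (-(v * (T / (2 * Real.pi)))) •
      (((Ioi (0 : ℝ)).indicator h v : ℝ) : ℂ) := by
    have hr : Integrable fun v => (((Ioi (0 : ℝ)).indicator h v : ℝ) : ℂ) :=
      ((integrable_indicator_iff measurableSet_Ioi).mpr hh).ofReal
    refine hr.bdd_mul (c := 1)
      (f := fun v => (Real.fourierChar (-(v * (T / (2 * Real.pi)))) : ℂ)) ?_
      (.of_forall fun v => (Circle.norm_coe _).le)
    exact (by fun_prop : Continuous fun v : ℝ =>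
      (Real.fourierChar (-(v * (T / (2 * Real.pi)))) : ℂ)).aestronglyMeasurable
  simp only [Function.comp_apply]
  rw [← RCLike.re_eq_complex_re, ← integral_re hi, ← integral_indicator measurableSet_Ioi]
  refine integral_congr_ae (.of_forall fun v => ?_)
  simp only [RCLike.re_eq_complex_re, Circle.smul_def, Real.fourierChar_apply, smul_eq_mul,
    Complex.re_mul_ofReal, Complex.exp_ofReal_mul_I_re]
  by_cases hv : v ∈ Ioi (0 : ℝ)
  · simp only [indicator_of_mem hv]
    rw [show 2 * Real.pi * -(v * (T / (2 * Real.pi))) = -(T * v) by field_simp, Real.cos_neg,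
      mul_comm]
  · simp [indicator_of_notMem hv]

/-- Fubini on the strip `0 < t ≤ T`, where `x * h x` is an integrable majorant, together with `∫ x
sin (t x) dt = 1 - cos (T x)`. -/
theorem intervalIntegral_sine_transform {h : ℝ → ℝ} (hh : IntegrableOn h (Ioi 0))
    (hx : IntegrableOn (fun x => x * h x) (Ioi 0)) {T : ℝ} (hT : 0 ≤ T) :
    ∫ t in (0 : ℝ)..T, ∫ x in Ioi (0 : ℝ), Real.sin (t * x) * (x * h x) =
      (∫ x in Ioi (0 : ℝ), h x) - ∫ x in Ioi (0 : ℝ), h x * Real.cos (T * x) := by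
  have hc : IntegrableOn (fun x => h x * Real.cos (T * x)) (Ioi 0) :=
    hh.mul_bdd (c := 1) (by fun_prop) (.of_forall fun x => Real.abs_cos_le_one _)
  rw [intervalIntegral.integral_of_le hT, integral_integral_swap, ← integral_sub hh hc]
  · refine setIntegral_congr_fun measurableSet_Ioi fun x hx0 => ?_
    have hx0' : x ≠ 0 := (mem_Ioi.mp hx0).ne'
    rw [← intervalIntegral.integral_of_le hT, intervalIntegral.integral_mul_const,
      intervalIntegral.integral_comp_mul_right _ hx0', integral_sin]
    simp only [zero_mul, Real.cos_zero, smul_eq_mul]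
    field_simp
  · have h1 : Integrable (fun _ : ℝ => (1 : ℝ)) (volume.restrict (Ioc 0 T)) :=
      integrable_const 1
    have h2 := h1.mul_prod hx
    simp only [one_mul] at h2
    exact h2.bdd_mul (c := 1) (by fun_prop) (.of_forall fun p => Real.abs_sin_le_one _)

theorem integral_sine_transform {h : ℝ → ℝ} (hh : IntegrableOn h (Ioi 0))
    (hx : IntegrableOn (fun x => x * h x) (Ioi 0))
    (hS : IntegrableOn (fun t => ∫ x in Ioi (0 : ℝ), Real.sin (t * x) * (x * h x)) (Ioi 0)) :
    ∫ t in Ioi (0 : ℝ), ∫ x in Ioi (0 : ℝ), Real.sin (t * x) * (x * h x) =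
      ∫ x in Ioi (0 : ℝ), h x := by
  refine tendsto_nhds_unique (intervalIntegral_tendsto_integral_Ioi 0 hS tendsto_id) ?_
  have h1 := (tendsto_integral_cos_mul hh).const_sub (∫ x in Ioi (0 : ℝ), h x)
  rw [sub_zero] at h1
  refine h1.congr' ?_
  filter_upwards [eventually_ge_atTop 0] with T hT
  exact (intervalIntegral_sine_transform hh hx hT).symm

/-! ### Moments of the hyperbolic secant -/

theorem integral_pow_mul_exp_neg_mul (n : ℕ) {r : ℝ} (hr : 0 < r) :
    ∫ t in Ioi (0 : ℝ), t ^ n * Real.exp (-(r * t)) = (n ! : ℝ) / r ^ (n + 1) := by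
  have h := Real.integral_rpow_mul_exp_neg_mul_Ioi (a := n + 1) (by positivity) hr
  rw [add_sub_cancel_right, Real.Gamma_nat_eq_factorial] at h
  simp only [Real.rpow_natCast] at h
  rw [h, ← Nat.cast_succ, Real.rpow_natCast, one_div, inv_pow, div_eq_inv_mul]

theorem integrableOn_pow_mul_exp_neg_mul (n : ℕ) {r : ℝ} (hr : 0 < r) :
    IntegrableOn (fun t : ℝ => t ^ n * Real.exp (-(r * t))) (Ioi 0) := by
  refine .of_integral_ne_zero ?_
  rw [integral_pow_mul_exp_neg_mul n hr]
  positivity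

theorem hasSum_inv_cosh {a : ℝ} (ha : 0 < a) :
    HasSum (fun j : ℕ => (-1 : ℝ) ^ j * (2 * Real.exp (-((2 * j + 1) * a))))
      (1 / Real.cosh a) := by
  have hq : |-(Real.exp (-(2 * a)))| < 1 := by
    rw [abs_neg, abs_of_pos (Real.exp_pos _), Real.exp_lt_one_iff]
    linarith
  convert! (hasSum_geometric_of_abs_lt_one hq).mul_left (2 * Real.exp (-a)) using 1
  · ext j
    rw [neg_pow (Real.exp _), ← Real.exp_nat_mul, show -((2 * (j : ℝ) + 1) * a) = -a + j * -(2 * a) by ring,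
      Real.exp_add]
    ring
  · have h2 : Real.exp (-(2 * a)) = (Real.exp a)⁻¹ ^ 2 := by
      rw [← Real.exp_neg, ← Real.exp_nat_mul]; congr 1; push_cast; ring
    have := Real.exp_pos a
    rw [Real.cosh_eq, h2, Real.exp_neg, sub_neg_eq_add]
    field_simp

theorem summable_inv_odd_pow {m : ℕ} (hm : 2 ≤ m) :
    Summable fun j : ℕ => 1 / (2 * (j : ℝ) + 1) ^ m := by
  have h := (Real.summable_one_div_nat_pow (p := m)).mpr (by lia)
  have h2 := h.comp_injective (i := fun j : ℕ => 2 * j + 1) fun a b hab => by simpa using hab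
  simpa [Function.comp_def] using h2

theorem summable_dirichletBeta {m : ℕ} (hm : 2 ≤ m) :
    Summable fun j : ℕ => (-1 : ℝ) ^ j / (2 * (j : ℝ) + 1) ^ m := by
  refine .of_norm ((summable_inv_odd_pow hm).congr fun j => ?_)
  rw [norm_div, norm_pow, norm_neg, norm_one, one_pow, Real.norm_of_nonneg (by positivity)]

/-- Termwise integration of the geometric series for `sech`. The L¹ norms sum like `∑
1/(2j+1)^(n+1)`, hence the condition on `n`. -/
theorem integral_pow_div_cosh {n : ℕ} (hn : n ≠ 0) :
    ∫ t in Ioi (0 : ℝ), t ^ n * (1 / Real.cosh (Real.pi * t / 2)) =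
      2 * (n ! : ℝ) / (Real.pi / 2) ^ (n + 1) * dirichletBeta (n + 1) := by
  have hr (j : ℕ) : 0 < (2 * (j : ℝ) + 1) * (Real.pi / 2) := by positivity
  have hint (j : ℕ) := (integrableOn_pow_mul_exp_neg_mul n (hr j)).const_mul ((-1 : ℝ) ^ j * 2)
  have hval (j : ℕ) : ∫ t in Ioi (0 : ℝ), ((-1 : ℝ) ^ j * 2) *
      (t ^ n * Real.exp (-((2 * (j : ℝ) + 1) * (Real.pi / 2) * t))) =
      2 * (n ! : ℝ) / (Real.pi / 2) ^ (n + 1) * ((-1) ^ j / (2 * (j : ℝ) + 1) ^ (n + 1)) := by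
    rw [integral_const_mul, integral_pow_mul_exp_neg_mul n (hr j), mul_pow]
    field_simp
  have hnorm (j : ℕ) : ∫ t in Ioi (0 : ℝ), ‖((-1 : ℝ) ^ j * 2) *
      (t ^ n * Real.exp (-((2 * (j : ℝ) + 1) * (Real.pi / 2) * t)))‖ =
      2 * (n ! : ℝ) / (Real.pi / 2) ^ (n + 1) * (1 / (2 * (j : ℝ) + 1) ^ (n + 1)) := by
    have : ∀ t ∈ Ioi (0 : ℝ), ‖((-1 : ℝ) ^ j * 2) *
        (t ^ n * Real.exp (-((2 * (j : ℝ) + 1) * (Real.pi / 2) * t)))‖ =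
        2 * (t ^ n * Real.exp (-((2 * (j : ℝ) + 1) * (Real.pi / 2) * t))) := fun t ht => by
      have ht' : 0 < t := ht
      rw [norm_mul, norm_mul, norm_pow, norm_neg, norm_one, one_pow, one_mul,
        Real.norm_of_nonneg zero_le_two, Real.norm_of_nonneg (by positivity)]
    rw [setIntegral_congr_fun measurableSet_Ioi this, integral_const_mul,
      integral_pow_mul_exp_neg_mul n (hr j), mul_pow]
    field_simp
  have hsum := hasSum_integral_of_summable_integral_norm hint (by
    simp only [hnorm]
    exact (summable_inv_odd_pow (by lia)).mul_left _)
  simp only [hval] at hsum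
  rw [dirichletBeta, ← tsum_mul_left, hsum.tsum_eq]
  refine setIntegral_congr_fun measurableSet_Ioi fun t ht => ?_
  have ht' : 0 < t := ht
  have ha : 0 < Real.pi * t / 2 := by positivity
  rw [← ((hasSum_inv_cosh ha).mul_left (t ^ n)).tsum_eq]
  refine tsum_congr fun j => ?_
  rw [show (2 * (j : ℝ) + 1) * (Real.pi / 2) * t = (2 * j + 1) * (Real.pi * t / 2) by ring]
  ring

theorem integrableOn_pow_div_cosh (n : ℕ) :
    IntegrableOn (fun t : ℝ => t ^ n * (1 / Real.cosh (Real.pi * t / 2))) (Ioi 0) := by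
  have h := (integrableOn_pow_mul_exp_neg_mul n (show 0 < Real.pi / 2 by positivity)).const_mul 2
  refine h.mono' (by fun_prop) ?_
  filter_upwards [ae_restrict_mem measurableSet_Ioi] with t ht
  have ht' : 0 < t := ht
  have h1 := inv_cosh_pow_le one_ne_zero (Real.pi * t / 2)
  rw [pow_one] at h1
  have := Real.cosh_pos (Real.pi * t / 2)
  rw [Real.norm_of_nonneg (by positivity)]
  calc t ^ n * (1 / Real.cosh (Real.pi * t / 2)) ≤ t ^ n * (2 * Real.exp (-(Real.pi * t / 2))) := by
        gcongr
    _ = _ := by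
        rw [show Real.pi / 2 * t = Real.pi * t / 2 by ring]
        ring

/-! ### The integrals `hInt` and the even beta values -/

theorem prod_sq_add_sq (n : ℕ) (t : ℝ) :
    ∏ j ∈ Finset.range n, ((2 * (j : ℝ) + 1) ^ 2 + t ^ 2) =
      (-4) ^ n * ∑ k ∈ Finset.range (n + 1), oddFactorialFirst n k * ((-1 / 4) ^ k * t ^ (2 * k)) := by
  -- At this point each factor of the generating polynomial is `-1/4` times `(2j+1)² + t²`.
  have h := sum_oddFactorialFirst_mul_pow n (-1 / 4 * t ^ 2)
  simp only [mul_pow, ← pow_mul] at h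
  have h4 : ((-4 : ℝ)) ^ n = ∏ _j ∈ Finset.range n, (-4 : ℝ) := by simp
  rw [h, h4, ← Finset.prod_mul_distrib]
  exact Finset.prod_congr rfl fun j _ => by ring

theorem integral_sin_mul_eq_sum (n : ℕ) (t : ℝ) :
    ∫ x in Ioi (0 : ℝ), Real.sin (t * x) * (x * hIntegrand (2 * (n + 1)) x) =
      ∑ k ∈ Finset.range (n + 1), (-4) ^ n / ((2 * n + 1)! : ℝ) * oddFactorialFirst n k *
        (-1 / 4) ^ k * (Real.pi / 2) *
          (t ^ (2 * k + 1) * (1 / Real.cosh (Real.pi * t / 2))) := by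
  have h1 : ∫ x in Ioi (0 : ℝ), Real.sin (t * x) * (x * hIntegrand (2 * (n + 1)) x) =
      ∫ x in Ioi (0 : ℝ), Real.sin (t * x) * (Real.sinh x / Real.cosh x ^ (2 * n + 1 + 1)) := by
    refine setIntegral_congr_fun measurableSet_Ioi fun x hx => ?_
    have hx0 : x ≠ 0 := (mem_Ioi.mp hx).ne'
    rw [hIntegrand, show 2 * (n + 1) = 2 * n + 1 + 1 by ring]
    field_simp
  rw [h1, integral_sin_mul_sinh_div_cosh_pow (by lia), sechPowCos_odd, prod_sq_add_sq,
    Finset.mul_sum, Finset.sum_div, Finset.sum_mul, Finset.mul_sum]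
  refine Finset.sum_congr rfl fun k _ => ?_
  rw [Nat.factorial_succ]
  have := Real.cosh_pos (Real.pi * t / 2)
  have : ((2 * n)! : ℝ) ≠ 0 := by positivity
  push_cast
  field_simp
  ring

theorem hInt_eq_sum (n : ℕ) :
    hInt (2 * (n + 1)) = (-1 : ℝ) ^ (n + 1) * 4 ^ (n + 1) / ((2 * n + 1)! : ℝ) *
      ∑ k ∈ Finset.range (n + 1), (-1 : ℝ) ^ (k + 1) * ((2 * k + 1)! : ℝ) *
        oddFactorialFirst n k * (dirichletBeta (2 * k + 2) / Real.pi ^ (2 * k + 1)) := by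
  have hint (k : ℕ) := (integrableOn_pow_div_cosh (2 * k + 1)).const_mul
    ((-4) ^ n / ((2 * n + 1)! : ℝ) * oddFactorialFirst n k * (-1 / 4) ^ k * (Real.pi / 2))
  have hx : IntegrableOn (fun x => x * hIntegrand (2 * (n + 1)) x) (Ioi 0) := by
    refine integrableOn_Ioi_of_abs_le (m := 2 * n + 1) (by lia)
      (measurable_id.mul (measurable_hIntegrand _)) fun x hx => ?_
    have h := abs_mul_sinh_div_cosh_pow_le (2 * n + 1) (c := 1) (by simp) x
    rw [hIntegrand]
    convert h using 2
    rw [show 2 * (n + 1) = 2 * n + 1 + 1 by ring]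
    field_simp
  have h := integral_sine_transform (integrableOn_hIntegrand (m := 2 * (n + 1)) (by lia)) hx (by
    simp only [integral_sin_mul_eq_sum]
    exact integrable_finsetSum _ fun k _ => hint k)
  rw [hInt, ← h]
  simp only [integral_sin_mul_eq_sum]
  rw [integral_finsetSum _ fun k _ => hint k, Finset.mul_sum]
  refine Finset.sum_congr rfl fun k _ => ?_
  rw [integral_const_mul, integral_pow_div_cosh (by lia), show 2 * k + 1 + 1 = 2 * k + 2 from rfl]
  have hπ := Real.pi_pos
  have e1 : (-4 : ℝ) ^ n = (-1) ^ n * 4 ^ n := by rw [← mul_pow]; norm_num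
  have e2 : (-1 / 4 : ℝ) ^ k = (-1) ^ k / 2 ^ (2 * k) := by rw [pow_mul, ← div_pow]; norm_num
  rw [e1, e2, div_pow, pow_succ (-1) n, pow_succ (-1) k, pow_succ 4 n, pow_succ Real.pi (2 * k + 1),
    pow_add 2 (2 * k) 2]
  field_simp
  ring

/-! ### Inversion of the two transformations. -/

theorem transform_iff_inverse_transform (a b : ℕ → ℝ) :
    (∀ n : ℕ, a n = (-1 : ℝ) ^ (n + 1) * 4 ^ (n + 1) / ((2 * n + 1)! : ℝ) *
      ∑ k ∈ Finset.range (n + 1),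
        (-1 : ℝ) ^ (k + 1) * ((2 * k + 1)! : ℝ) * oddFactorialFirst n k * b k) ↔
    (∀ n : ℕ, b n = ((4 : ℝ) ^ (n + 1))⁻¹ / ((2 * n + 1)! : ℝ) *
      ∑ k ∈ Finset.range (n + 1), dCoeff (n + 1) (k + 1) * a k) := by
  have hs (n : ℕ) : ((-1 : ℝ)) ^ n * (-1) ^ n = 1 := by rw [← mul_pow]; simp
  -- Rescaled in this way, the sequences are related by the bare first-kind and second-kind arrays.
  let A (n : ℕ) : ℝ := (-1) ^ n * ((2 * n + 1)! : ℝ) / 4 ^ (n + 1) * a n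
  let B (n : ℕ) : ℝ := (-1) ^ n * ((2 * n + 1)! : ℝ) * b n
  have hA (n : ℕ) : a n = (-1 : ℝ) ^ (n + 1) * 4 ^ (n + 1) / ((2 * n + 1)! : ℝ) *
      ∑ k ∈ Finset.range (n + 1),
        (-1 : ℝ) ^ (k + 1) * ((2 * k + 1)! : ℝ) * oddFactorialFirst n k * b k ↔
      A n = ∑ k ∈ Finset.range (n + 1), oddFactorialFirst n k * B k := by
    have e : ∑ k ∈ Finset.range (n + 1),
        (-1 : ℝ) ^ (k + 1) * ((2 * k + 1)! : ℝ) * oddFactorialFirst n k * b k =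
        -∑ k ∈ Finset.range (n + 1), oddFactorialFirst n k * B k := by
      rw [← Finset.sum_neg_distrib]
      exact Finset.sum_congr rfl fun k _ => by simp only [B]; ring
    have hf : ((2 * n + 1)! : ℝ) ≠ 0 := by positivity
    rw [e]
    generalize ∑ k ∈ Finset.range (n + 1), oddFactorialFirst n k * B k = s
    simp only [A]
    constructor <;> intro h
    · rw [h]
      field_simp
      linear_combination s * hs n
    · rw [← h]
      field_simp
      linear_combination (-(a n)) * hs n
  have hB (n : ℕ) : b n = ((4 : ℝ) ^ (n + 1))⁻¹ / ((2 * n + 1)! : ℝ) *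
      ∑ k ∈ Finset.range (n + 1), dCoeff (n + 1) (k + 1) * a k ↔
      B n = ∑ k ∈ Finset.range (n + 1), oddFactorialSecond n k * A k := by
    have e : ∑ k ∈ Finset.range (n + 1), dCoeff (n + 1) (k + 1) * a k =
        (-1) ^ n * 4 ^ (n + 1) * ∑ k ∈ Finset.range (n + 1), oddFactorialSecond n k * A k := by
      rw [Finset.mul_sum]
      refine Finset.sum_congr rfl fun k _ => ?_
      simp only [A]
      rw [dCoeff_eq, pow_add, pow_succ 4 k]
      field_simp
      ring
    have hf : ((2 * n + 1)! : ℝ) ≠ 0 := by positivity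
    rw [e]
    generalize ∑ k ∈ Finset.range (n + 1), oddFactorialSecond n k * A k = s
    simp only [B]
    constructor <;> intro h
    · rw [h]
      field_simp
      linear_combination s * hs n
    · rw [← h]
      field_simp
      linear_combination (-(b n)) * hs n
  rw [forall_congr' hA, forall_congr' hB]
  exact ⟨eq_sum_of_eq_sum_of_orthogonal (fun _ _ => oddFactorialFirst_eq_zero_of_lt)
      sum_oddFactorialSecond_mul_first,
    eq_sum_of_eq_sum_of_orthogonal (fun _ _ => oddFactorialSecond_eq_zero_of_lt)
      sum_oddFactorialFirst_mul_second⟩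

theorem forall_one_le_iff {p : ℕ → Prop} : (∀ n, 1 ≤ n → p n) ↔ ∀ n, p (n + 1) :=
  ⟨fun h n => h _ n.succ_pos, fun h n hn => by
    obtain ⟨m, rfl⟩ := Nat.exists_eq_add_of_le' hn; exact h m⟩

theorem theorem4 :
    -- the integrals `h_{2n}` and the series `β(2n)` converge absolutely
    (∀ n : ℕ, 1 ≤ n → IntegrableOn (hIntegrand (2 * n)) (Ioi (0 : ℝ)) volume) ∧
    (∀ n : ℕ, 1 ≤ n → Summable (fun j : ℕ => (-1 : ℝ) ^ j / (2 * (j : ℝ) + 1) ^ (2 * n))) ∧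
    -- the even beta values through the integrals
    (∀ n : ℕ, 1 ≤ n →
      dirichletBeta (2 * n) / Real.pi ^ (2 * n - 1) =
        ((4 : ℝ) ^ n)⁻¹ / ((2 * n - 1)! : ℝ) *
          ∑ k ∈ Finset.Icc 1 n, dCoeff n k * hInt (2 * k)) ∧
    -- the coefficients as derivatives of `sin^{2k-1}`, at `0` and as a limit at `0`
    (∀ n k : ℕ, 1 ≤ k → k ≤ n →
      iteratedDeriv (2 * n - 1) (fun u : ℝ => Real.sin u ^ (2 * k - 1)) 0 = dCoeff n k ∧
      Tendsto (fun t : ℝ => iteratedDeriv (2 * n - 1) (fun u : ℝ => Real.sin u ^ (2 * k - 1)) t)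
        (𝓝[≠] 0) (𝓝 (dCoeff n k))) ∧
    -- the representation of the integrals through the even beta values
    (∀ n : ℕ, 1 ≤ n →
      hInt (2 * n) =
        (-1 : ℝ) ^ n * 4 ^ n / ((2 * n - 1)! : ℝ) *
          ∑ k ∈ Finset.Icc 1 n,
            (-1 : ℝ) ^ k * ((2 * k - 1)! : ℝ) *
              centralFactorialFirst (2 * n - 1) (2 * k - 1) *
                (dirichletBeta (2 * k) / Real.pi ^ (2 * k - 1))) ∧
    -- the two transformations are inverse to each other
    (∀ a b : ℕ → ℝ,
      (∀ n : ℕ, 1 ≤ n →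
        a n =
          (-1 : ℝ) ^ n * 4 ^ n / ((2 * n - 1)! : ℝ) *
            ∑ k ∈ Finset.Icc 1 n,
              (-1 : ℝ) ^ k * ((2 * k - 1)! : ℝ) *
                centralFactorialFirst (2 * n - 1) (2 * k - 1) * b k) ↔
      (∀ n : ℕ, 1 ≤ n →
        b n =
          ((4 : ℝ) ^ n)⁻¹ / ((2 * n - 1)! : ℝ) *
            ∑ k ∈ Finset.Icc 1 n, dCoeff n k * a k)) := by
  have hodd (n : ℕ) : 2 * (n + 1) - 1 = 2 * n + 1 := by lia
  refine ⟨fun n hn => integrableOn_hIntegrand (by lia), fun n hn => summable_dirichletBeta (by lia),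
    ?_, ?_, ?_, fun a b => ?_⟩
  · rw [forall_one_le_iff]
    simp only [sum_Icc_one_succ, hodd]
    -- Formula (i) is the inversion applied to (ii); no further analysis enters.
    exact (transform_iff_inverse_transform (fun n => hInt (2 * (n + 1)))
      (fun n => dirichletBeta (2 * (n + 1)) / Real.pi ^ (2 * n + 1))).mp hInt_eq_sum
  · intro n k hk hkn
    obtain ⟨k, rfl⟩ := Nat.exists_eq_add_of_le' hk
    obtain ⟨n, rfl⟩ := Nat.exists_eq_add_of_le' (hk.trans hkn)
    rw [hodd, hodd, dCoeff_eq, ← iteratedDeriv_sin_pow_zero]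
    exact ⟨rfl, tendsto_iteratedDeriv_sin_pow _ _⟩
  · rw [forall_one_le_iff]
    simp only [sum_Icc_one_succ, hodd]
    exact hInt_eq_sum
  · rw [forall_one_le_iff, forall_one_le_iff]
    simp only [sum_Icc_one_succ, hodd]
    exact transform_iff_inverse_transform (fun n => a (n + 1)) (fun n => b (n + 1))
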